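/- Let $\mathbb{H}$ be the real algebra of quaternions and $\mathbb{S}=\{I\in\mathbb{H}: I^2=-1\}$. A real differentiable function $f:\mathbb{H}\to\mathbb{H}$ is called (slice-)regular if for every $I\in\mathbb{S}$ and all $x,y\in\mathbb{R}$ $$\frac12\left(\frac{\partial}{\partial x}+I\frac{\partial}{\partial y}\right)f(x+Iy)=0 .$$ It is called biregular if it is regular and has a two-sided inverse $\mathbb{H}\to\mathbb{H}$ that is regular as well. (1) A function $f:\mathbb{H}\to\mathbb{H}$ is regular and injective if and only if there exist $a,b\in\mathbb{H}$ with $a\neq 0$ such that $f(q)=qa+b$ for all $q\in\mathbb{H}$. (2) A function $f:\mathbb{H}\to\mathbb{H}$ is biregular if and only if it is a regular affine transformation, i.e. of the form $f(q)=qa+b$ with $a,b\in\mathbb{H}$, $a\neq0$. Hence the set $\mathrm{Aut}(\mathbb{H})$ of biregular functions is a group under composition, and it coincides with the group $\mathcal{A}$ of regular affine transformations. -/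

import Mathlib

open scoped Quaternion

noncomputable section

namespace SliceRegular

/-- The sphere `𝕊 = {I ∈ ℍ : I² = -1}` of quaternionic imaginary units. -/
def imaginaryUnits : Set ℍ[ℝ] := {I | I ^ 2 = -1}

/-- The operator `(1/2) (∂/∂x + I ∂/∂y)` applied to the restriction of `f` to the complex line
`ℝ + I ℝ`, evaluated at the point `x + I y`. -/
def dbar (I : ℍ[ℝ]) (f : ℍ[ℝ] → ℍ[ℝ]) (x y : ℝ) : ℍ[ℝ] :=
  (1 / 2 : ℝ) •
    (deriv (fun t : ℝ => f ((t : ℍ[ℝ]) + I * (y : ℍ[ℝ]))) x +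
      I * deriv (fun t : ℝ => f ((x : ℍ[ℝ]) + I * (t : ℍ[ℝ]))) y)

/-- (Slice-)regular functions on the whole of `ℍ`: real differentiable functions whose restriction
to every complex line `ℝ + I ℝ` is holomorphic. -/
def IsSliceRegular (f : ℍ[ℝ] → ℍ[ℝ]) : Prop :=
  Differentiable ℝ f ∧ ∀ I ∈ imaginaryUnits, ∀ x y : ℝ, dbar I f x y = 0

/-- Biregular functions `ℍ → ℍ`: regular functions having a regular (two-sided) inverse. -/
def IsBiregular (f : ℍ[ℝ] → ℍ[ℝ]) : Prop :=
  IsSliceRegular f ∧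
    ∃ g : ℍ[ℝ] → ℍ[ℝ], IsSliceRegular g ∧ Function.LeftInverse g f ∧ Function.RightInverse g f

/-- Regular affine transformations `q ↦ q a + b` with `a ≠ 0`. -/
def IsRegularAffine (f : ℍ[ℝ] → ℍ[ℝ]) : Prop :=
  ∃ a b : ℍ[ℝ], a ≠ 0 ∧ ∀ q : ℍ[ℝ], f q = q * a + b

/-- `Aut(ℍ)`, as a set of permutations of `ℍ`. -/
def aut : Set (Equiv.Perm ℍ[ℝ]) := {e | IsBiregular e}

/-- The group `𝒜` of regular affine transformations, under composition. -/
def affineGroup : Subgroup (Equiv.Perm ℍ[ℝ]) where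
  carrier := {e | IsRegularAffine e}
  one_mem' := ⟨1, 0, one_ne_zero, fun q => by simp⟩
  mul_mem' := by
    rintro e e' ⟨a, b, ha, h⟩ ⟨a', b', ha', h'⟩
    refine ⟨a' * a, b' * a + b, mul_ne_zero ha' ha, fun q => ?_⟩
    rw [Equiv.Perm.mul_apply, h, h', add_mul, mul_assoc, add_assoc]
  inv_mem' := by
    rintro e ⟨a, b, ha, h⟩
    refine ⟨a⁻¹, -(b * a⁻¹), inv_ne_zero ha, fun q => ?_⟩
    rw [Equiv.Perm.inv_eq_iff_eq, h, add_mul, neg_mul, inv_mul_cancel_right₀ ha,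
      inv_mul_cancel_right₀ ha, neg_add_cancel_right]

end SliceRegular

end

open scoped InnerProductSpace

noncomputable section

namespace SliceRegular

/-! A regular `f` is carried by entire stem functions `F k`, real on the real line: `f (x + Iy) = α
+ Iβ`, with `α`, `β` independent of `I` (`exists_stem`). The entire function `N c = ∑ (F k - c k)²`
controls the fibre over `c`: some `I` satisfies `‖f (x + Iy) - c‖² ≤ ‖N c (x + iy)‖`, so each zero
of `N c` gives a preimage of `c`.

Let `f` be injective and `t` real with some `F k` having nonzero derivative there. Then `N (f t)`
vanishes only at `t`, to order exactly two. Persistence of zeros shows that values near `f t` are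
taken near `t`, hence not far away, so `N (f t)` is bounded below off a disc. Thus `(z - t)² / N (f
t)` is zero-free of at most quadratic growth, hence constant, and `‖f s - f t‖² = A (s - t)²` for
real `s` (`exists_norm_sub_sq_eq`). Two such base points make `f` affine on the real line, and the
identity principle extends this to all of `ℍ`. -/

/-- The real-linear map `q ↦ ⟪v, q⟫ - i ⟪v, I q⟫`; when `I² = -1` it intertwines left
multiplication by `I` with multiplication by the complex unit. -/
def sliceFunctional (I v : ℍ[ℝ]) : ℍ[ℝ] →L[ℝ] ℂ :=
  Complex.ofRealCLM ∘L innerSL ℝ v -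
    Complex.I • (Complex.ofRealCLM ∘L innerSL ℝ v ∘L ContinuousLinearMap.mul ℝ ℍ[ℝ] I)

theorem sliceFunctional_apply (I v q : ℍ[ℝ]) :
    sliceFunctional I v q = (⟪v, q⟫_ℝ : ℂ) - Complex.I * (⟪v, I * q⟫_ℝ : ℂ) := rfl

theorem sliceFunctional_re (I v q : ℍ[ℝ]) : (sliceFunctional I v q).re = ⟪v, q⟫_ℝ := by
  simp [sliceFunctional_apply]

theorem sliceFunctional_mul {I : ℍ[ℝ]} (hI : I ∈ imaginaryUnits) (v q : ℍ[ℝ]) :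
    sliceFunctional I v (I * q) = Complex.I * sliceFunctional I v q := by
  have h : I * (I * q) = -q := by
    rw [← mul_assoc, ← pow_two, show I ^ 2 = -1 from hI, neg_one_mul]
  rw [sliceFunctional_apply, sliceFunctional_apply, h, inner_neg_right]
  push_cast
  linear_combination (⟪v, I * q⟫_ℝ : ℂ) * Complex.I_sq

/-- The parametrization `x + iy ↦ x + Iy` of the slice `ℝ + Iℝ`. -/
def sliceMap (I : ℍ[ℝ]) : ℂ →L[ℝ] ℍ[ℝ] :=
  Complex.reCLM.smulRight (1 : ℍ[ℝ]) + Complex.imCLM.smulRight I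

theorem sliceMap_apply (I : ℍ[ℝ]) (z : ℂ) : sliceMap I z = (z.re : ℍ[ℝ]) + I * (z.im : ℍ[ℝ]) := by
  simp [sliceMap, Quaternion.mul_coe_eq_smul, ← Quaternion.coe_mul_eq_smul]

theorem sliceMap_ofReal (I : ℍ[ℝ]) (t : ℝ) : sliceMap I t = (t : ℍ[ℝ]) := by
  simp [sliceMap_apply]

theorem differentiable_sliceFunctional_comp {f : ℍ[ℝ] → ℍ[ℝ]} (hf : IsSliceRegular f)
    {I : ℍ[ℝ]} (hI : I ∈ imaginaryUnits) (v : ℍ[ℝ]) :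
    Differentiable ℂ fun z => sliceFunctional I v (f (sliceMap I z)) := by
  intro z
  have hg : HasFDerivAt (fun z => f (sliceMap I z))
      ((fderiv ℝ f (sliceMap I z)) ∘L sliceMap I) z :=
    (hf.1 _).hasFDerivAt.comp z (sliceMap I).hasFDerivAt
  have hG := (sliceFunctional I v).hasFDerivAt.comp z hg
  rw [differentiableAt_complex_iff_differentiableAt_real]
  refine ⟨hG.differentiableAt, ?_⟩
  have hx : HasDerivAt (fun t : ℝ => f ((t : ℍ[ℝ]) + I * (z.im : ℍ[ℝ])))
      (fderiv ℝ f (sliceMap I z) 1) z.re := by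
    have h1 : HasDerivAt (fun t : ℝ => (t : ℍ[ℝ]) + I * (z.im : ℍ[ℝ])) 1 z.re := by
      have := ((hasDerivAt_id z.re).smul_const (1 : ℍ[ℝ])).add_const (I * (z.im : ℍ[ℝ]))
      simpa [← Quaternion.coe_mul_eq_smul] using this
    have h2 := hf.1 (sliceMap I z)
    rw [sliceMap_apply] at h2 ⊢
    exact h2.hasFDerivAt.comp_hasDerivAt z.re h1
  have hy : HasDerivAt (fun t : ℝ => f ((z.re : ℍ[ℝ]) + I * (t : ℍ[ℝ])))
      (fderiv ℝ f (sliceMap I z) I) z.im := by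
    have h1 : HasDerivAt (fun t : ℝ => (z.re : ℍ[ℝ]) + I * (t : ℍ[ℝ])) I z.im := by
      have := ((hasDerivAt_id z.im).smul_const I).const_add (z.re : ℍ[ℝ])
      simpa [Quaternion.mul_coe_eq_smul] using this
    have h2 := hf.1 (sliceMap I z)
    rw [sliceMap_apply] at h2 ⊢
    exact h2.hasFDerivAt.comp_hasDerivAt z.im h1
  have hd := hf.2 I hI z.re z.im
  rw [dbar, hx.deriv, hy.deriv, smul_eq_zero_iff_right (by norm_num)] at hd
  have hd' := congrArg (sliceFunctional I v) hd
  rw [map_add, sliceFunctional_mul hI, map_zero] at hd'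
  have e1 : sliceMap I 1 = 1 := by simp [sliceMap]
  have e2 : sliceMap I Complex.I = I := by simp [sliceMap]
  erw [hG.fderiv]
  simp only [ContinuousLinearMap.comp_apply, e1, e2, smul_eq_mul]
  linear_combination (-Complex.I) * hd' +
    sliceFunctional I v (fderiv ℝ f (sliceMap I z) I) * Complex.I_sq

/-- Two entire functions that agree on the real line are equal. -/
theorem eq_of_forall_ofReal_eq {g h : ℂ → ℂ} (hg : Differentiable ℂ g) (hh : Differentiable ℂ h)
    (H : ∀ t : ℝ, g t = h t) : g = h := by
  refine AnalyticOnNhd.eq_of_frequently_eq (z₀ := 0)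
    (hg.differentiableOn.analyticOnNhd isOpen_univ)
    (hh.differentiableOn.analyticOnNhd isOpen_univ) ?_
  have : Filter.Tendsto (fun t : ℝ => (t : ℂ)) (nhdsWithin 0 {0}ᶜ) (nhdsWithin 0 {0}ᶜ) := by
    refine tendsto_nhdsWithin_iff.2 ⟨?_, ?_⟩
    · exact (Complex.continuous_ofReal.tendsto' 0 0 (by simp)).mono_left nhdsWithin_le_nhds
    · filter_upwards [self_mem_nhdsWithin] with t ht
      simpa using ht
  exact this.frequently (Filter.Eventually.of_forall H).frequently

/-! ### Imaginary units and slices -/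

theorem exists_imaginaryUnit : ∃ I : ℍ[ℝ], I ∈ imaginaryUnits := by
  refine ⟨((Complex.I : ℂ) : ℍ[ℝ]), ?_⟩
  rw [imaginaryUnits, Set.mem_ofPred_eq, pow_two, ← Quaternion.coeComplex_mul, Complex.I_mul_I]
  ext <;> simp

theorem norm_of_mem_imaginaryUnits {I : ℍ[ℝ]} (hI : I ∈ imaginaryUnits) : ‖I‖ = 1 := by
  have h := congrArg norm (show I ^ 2 = -1 from hI)
  rw [norm_pow, norm_neg, norm_one] at h
  exact (pow_eq_one_iff_of_nonneg (norm_nonneg I) two_ne_zero).1 h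

theorem re_of_mem_imaginaryUnits {I : ℍ[ℝ]} (hI : I ∈ imaginaryUnits) : I.re = 0 := by
  have h : I ^ 2 = -((Quaternion.normSq I : ℝ) : ℍ[ℝ]) := by
    rw [Quaternion.normSq_eq_norm_mul_self, norm_of_mem_imaginaryUnits hI,
      show I ^ 2 = -1 from hI]
    simp
  exact Quaternion.sq_eq_neg_normSq.1 h

theorem exists_im_eq_norm_smul (q : ℍ[ℝ]) : ∃ I ∈ imaginaryUnits, q.im = ‖q.im‖ • I := by
  by_cases h : q.im = 0
  · obtain ⟨I, hI⟩ := exists_imaginaryUnit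
    exact ⟨I, hI, by simp [h]⟩
  · have h0 : ‖q.im‖ ≠ 0 := norm_ne_zero_iff.2 h
    refine ⟨‖q.im‖⁻¹ • q.im, ?_, ?_⟩
    · rw [imaginaryUnits, Set.mem_ofPred_eq, smul_pow, Quaternion.im_sq,
        Quaternion.normSq_eq_norm_mul_self, smul_neg, ← Quaternion.coe_smul, smul_eq_mul,
        ← pow_two, ← mul_pow, inv_mul_cancel₀ h0]
      simp
    · rw [smul_smul, mul_inv_cancel₀ h0, one_smul]

theorem neg_mem_imaginaryUnits {I : ℍ[ℝ]} (hI : I ∈ imaginaryUnits) : -I ∈ imaginaryUnits := by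
  rw [imaginaryUnits, Set.mem_ofPred_eq, neg_sq]
  exact hI

theorem exists_sliceMap_eq (q : ℍ[ℝ]) : ∃ I ∈ imaginaryUnits, ∃ z, q = sliceMap I z := by
  obtain ⟨I, hI, h⟩ := exists_im_eq_norm_smul q
  refine ⟨I, hI, ⟨q.re, ‖q.im‖⟩, ?_⟩
  rw [sliceMap_apply, Quaternion.mul_coe_eq_smul, ← h, Quaternion.re_add_im]

theorem norm_sliceMap {I : ℍ[ℝ]} (hI : I ∈ imaginaryUnits) (z : ℂ) : ‖sliceMap I z‖ = ‖z‖ := by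
  rw [← sq_eq_sq₀ (norm_nonneg _) (norm_nonneg _), sliceMap_apply, norm_add_sq_real, norm_mul,
    norm_of_mem_imaginaryUnits hI, Complex.sq_norm, Complex.normSq_apply, Quaternion.inner_def,
    Quaternion.coe_mul_eq_smul, Quaternion.mul_coe_eq_smul]
  simp [re_of_mem_imaginaryUnits hI]
  ring

/-! ### Stem functions and the sum of squares -/

/-- A regular function is induced by entire stem functions, real on the real line. -/
theorem exists_stem {ι : Type*} [Fintype ι] (b : OrthonormalBasis ι ℝ ℍ[ℝ])
    {f : ℍ[ℝ] → ℍ[ℝ]} (hf : IsSliceRegular f) :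
    ∃ F : ι → ℂ → ℂ, (∀ k, Differentiable ℂ (F k)) ∧
      (∀ k, ∀ t : ℝ, F k t = (⟪b k, f t⟫_ℝ : ℂ)) ∧
      ∀ I ∈ imaginaryUnits, ∀ z, f (sliceMap I z) =
        ∑ k, (F k z).re • b k + I * ∑ k, (F k z).im • b k := by
  obtain ⟨J, hJ⟩ := exists_imaginaryUnit
  let G : ι → ℂ → ℂ := fun k z => sliceFunctional J (b k) (f (sliceMap J z))
  have hG k : Differentiable ℂ (G k) := differentiable_sliceFunctional_comp hf hJ (b k)
  -- Averaging with the Schwarz reflection keeps only the real part of `G k` on the real line, which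
  -- is a coordinate of `f`.
  let F : ι → ℂ → ℂ := fun k z => (G k z + starRingEnd ℂ (G k (starRingEnd ℂ z))) / 2
  have hF k : Differentiable ℂ (F k) := by
    refine ((hG k).add ?_).div_const 2
    intro z
    simpa [Function.comp_def] using (hG k (starRingEnd ℂ z)).star_star
  have hFr : ∀ k, ∀ t : ℝ, F k t = (⟪b k, f t⟫_ℝ : ℂ) := by
    intro k t
    simp only [F, Complex.conj_ofReal, Complex.add_conj, G, sliceFunctional_re, sliceMap_ofReal]
    push_cast
    ring
  refine ⟨F, hF, hFr, fun I hI z => ?_⟩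
  have key : ∀ v : ℍ[ℝ], ∀ z, sliceFunctional I v (∑ k, (F k z).re • b k +
      I * ∑ k, (F k z).im • b k) = ∑ k, F k z * sliceFunctional I v (b k) := by
    intro v z
    rw [map_add, sliceFunctional_mul hI, map_sum, map_sum, Finset.mul_sum,
      ← Finset.sum_add_distrib]
    refine Finset.sum_congr rfl fun k _ => ?_
    rw [map_smul, map_smul, Complex.real_smul, Complex.real_smul]
    conv_rhs => rw [← Complex.re_add_im (F k z)]
    ring
  have hreal : ∀ t : ℝ, f (sliceMap I t) = ∑ k, (F k t).re • b k + I * ∑ k, (F k t).im • b k := by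
    intro t
    simp only [hFr, Complex.ofReal_re, Complex.ofReal_im, zero_smul, Finset.sum_const_zero,
      mul_zero, add_zero, sliceMap_ofReal]
    exact (b.sum_repr' (f t)).symm
  refine ext_inner_left ℝ fun v => ?_
  rw [← sliceFunctional_re I, ← sliceFunctional_re I v (_ + _), key v z]
  congr 1
  refine congrFun (eq_of_forall_ofReal_eq (differentiable_sliceFunctional_comp hf hI v)
    (Differentiable.fun_sum fun k _ => (hF k).mul_const _) fun t => ?_) z
  rw [hreal t, key v t]

/-- Choose `I` opposite to the imaginary part of `α * star β`, whose norm is `n`. With `S = ‖α‖² +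
‖β‖²`, the left side is `S - 2n`, while the square of the right side is `S² - 4n² = (S - 2n)(S +
2n)`. -/
theorem exists_normSq_add_mul_le (α β : ℍ[ℝ]) : ∃ I ∈ imaginaryUnits,
    ‖α + I * β‖ ^ 2 ≤ ‖(((‖α‖ ^ 2 - ‖β‖ ^ 2 : ℝ) : ℂ) + 2 * (⟪α, β⟫_ℝ : ℂ) * Complex.I)‖ := by
  obtain ⟨J, hJ, hu⟩ := exists_im_eq_norm_smul (α * star β)
  obtain ⟨I, rfl⟩ : ∃ I, J = -I := ⟨-J, (neg_neg J).symm⟩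
  have hI : I ∈ imaginaryUnits := neg_neg I ▸ neg_mem_imaginaryUnits hJ
  rw [smul_neg] at hu
  refine ⟨I, hI, ?_⟩
  set n : ℝ := ‖(α * star β).im‖ with hn
  have hI1 := norm_of_mem_imaginaryUnits hI
  have hinner : ⟪α, I * β⟫_ℝ = -n := by
    have h1 : ⟪α, I * β⟫_ℝ = ⟪α * star β, I⟫_ℝ := by
      rw [Quaternion.inner_def, Quaternion.inner_def, star_mul, mul_assoc]
    rw [h1, ← Quaternion.re_add_im (α * star β), inner_add_left, hu, inner_neg_left,
      real_inner_smul_left, real_inner_self_eq_norm_sq, hI1, Quaternion.inner_def,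
      Quaternion.coe_mul_eq_smul]
    simp [re_of_mem_imaginaryUnits hI]
  have hprod : ‖α‖ ^ 2 * ‖β‖ ^ 2 = ⟪α, β⟫_ℝ ^ 2 + n ^ 2 := by
    have h1 : ‖α * star β‖ ^ 2 = ‖((α * star β).re : ℍ[ℝ])‖ ^ 2 + n ^ 2 := by
      conv_lhs => rw [← Quaternion.re_add_im (α * star β)]
      rw [norm_add_sq_real, hn, Quaternion.inner_def, Quaternion.coe_mul_eq_smul]
      simp
    rw [norm_mul, Quaternion.norm_star, Quaternion.norm_coe, Real.norm_eq_abs, sq_abs,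
      ← Quaternion.inner_def, mul_pow] at h1
    exact h1
  have hsq : ‖α + I * β‖ ^ 2 = ‖α‖ ^ 2 + ‖β‖ ^ 2 - 2 * n := by
    rw [norm_add_sq_real, hinner, norm_mul, hI1]
    ring
  have hn0 : 0 ≤ n := norm_nonneg _
  have h0 : 0 ≤ ‖α‖ ^ 2 + ‖β‖ ^ 2 - 2 * n := hsq ▸ sq_nonneg _
  rw [hsq]
  refine le_of_sq_le_sq ?_ (norm_nonneg _)
  rw [Complex.sq_norm, Complex.normSq_apply]
  simp only [Complex.add_re, Complex.add_im, Complex.mul_re, Complex.mul_im, Complex.ofReal_re,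
    Complex.ofReal_im, Complex.I_re, Complex.I_im, Complex.re_ofNat, Complex.im_ofNat]
  nlinarith [mul_nonneg h0 hn0]

theorem sum_sq_eq {ι : Type*} [Fintype ι] (b : OrthonormalBasis ι ℝ ℍ[ℝ]) (w : ι → ℂ) :
    ∑ k, w k ^ 2 =
      ((‖∑ k, (w k).re • b k‖ ^ 2 - ‖∑ k, (w k).im • b k‖ ^ 2 : ℝ) : ℂ) +
        2 * (⟪∑ k, (w k).re • b k, ∑ k, (w k).im • b k⟫_ℝ : ℂ) * Complex.I := by
  rw [← real_inner_self_eq_norm_sq, ← real_inner_self_eq_norm_sq, b.orthonormal.inner_sum,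
    b.orthonormal.inner_sum, b.orthonormal.inner_sum]
  push_cast
  rw [Finset.mul_sum, Finset.sum_mul, ← Finset.sum_sub_distrib, ← Finset.sum_add_distrib]
  refine Finset.sum_congr rfl fun k _ => ?_
  simp only [conj_trivial]
  conv_lhs => rw [← Complex.re_add_im (w k)]
  linear_combination ((w k).im : ℂ) ^ 2 * Complex.I_sq

theorem exists_norm_sub_sq_le {ι : Type*} [Fintype ι] (b : OrthonormalBasis ι ℝ ℍ[ℝ])
    {f : ℍ[ℝ] → ℍ[ℝ]} {F : ι → ℂ → ℂ}
    (hF : ∀ I ∈ imaginaryUnits, ∀ z, f (sliceMap I z) =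
      ∑ k, (F k z).re • b k + I * ∑ k, (F k z).im • b k) (c : ℍ[ℝ]) (z : ℂ) :
    ∃ I ∈ imaginaryUnits,
      ‖f (sliceMap I z) - c‖ ^ 2 ≤ ‖∑ k, (F k z - (⟪b k, c⟫_ℝ : ℂ)) ^ 2‖ := by
  obtain ⟨I, hI, h⟩ := exists_normSq_add_mul_le
    (∑ k, (F k z - (⟪b k, c⟫_ℝ : ℂ)).re • b k) (∑ k, (F k z - (⟪b k, c⟫_ℝ : ℂ)).im • b k)
  refine ⟨I, hI, ?_⟩
  rw [sum_sq_eq b, hF I hI]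
  convert h using 3
  simp only [Complex.sub_re, Complex.sub_im, Complex.ofReal_re, Complex.ofReal_im, sub_zero,
    sub_smul, Finset.sum_sub_distrib, b.sum_repr' c]
  abel

/-- A regular function is determined by its values on the real line. -/
theorem IsSliceRegular.eq_of_forall_coe_eq {f g : ℍ[ℝ] → ℍ[ℝ]} (hf : IsSliceRegular f)
    (hg : IsSliceRegular g) (h : ∀ t : ℝ, f t = g t) : f = g := by
  funext q
  obtain ⟨I, hI, z, rfl⟩ := exists_sliceMap_eq q
  refine ext_inner_left ℝ fun v => ?_
  rw [← sliceFunctional_re I, ← sliceFunctional_re I v (g _)]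
  congr 1
  refine congrFun (eq_of_forall_ofReal_eq (differentiable_sliceFunctional_comp hf hI v)
    (differentiable_sliceFunctional_comp hg hI v) fun t => ?_) z
  rw [sliceMap_ofReal, h]

/-! ### Rigidity and persistence of zeros -/

theorem differentiable_dslope {g : ℂ → ℂ} (hg : Differentiable ℂ g) (c : ℂ) :
    Differentiable ℂ (dslope g c) :=
  differentiableOn_univ.1 ((Complex.differentiableOn_dslope Filter.univ_mem).2 hg.differentiableOn)

theorem sub_mul_dslope_add (g : ℂ → ℂ) (c z : ℂ) : g z = g c + (z - c) * dslope g c z := by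
  rw [← smul_eq_mul, sub_smul_dslope]
  ring

/-- A zero-free entire function of at most quadratic growth is constant. -/
theorem eq_const_of_ne_zero_of_norm_le_sq {g : ℂ → ℂ} (hg : Differentiable ℂ g)
    (h0 : ∀ z, g z ≠ 0) {c : ℂ} {C : ℝ} (hC : ∀ z, 1 < ‖z - c‖ → ‖g z‖ ≤ C * ‖z - c‖ ^ 2) (z : ℂ) :
    g z = g c := by
  set a := dslope g c c
  set d := dslope (dslope g c) c
  have hdd : Differentiable ℂ d := differentiable_dslope (differentiable_dslope hg c) c
  have hexp : ∀ z, g z = g c + (z - c) * (a + (z - c) * d z) := fun z => by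
    rw [sub_mul_dslope_add g c z, sub_mul_dslope_add (dslope g c) c z]
  -- The growth bound makes the second divided difference bounded; Liouville then turns `g` into a
  -- polynomial.
  have hbdd : Bornology.IsBounded (Set.range d) := by
    have hK := ((isCompact_closedBall c 1).image hdd.continuous).isBounded
    obtain ⟨M, hM⟩ := isBounded_iff_forall_norm_le.1 hK
    refine isBounded_iff_forall_norm_le.2 ⟨max M (C + ‖g c‖ + ‖a‖), ?_⟩
    rintro _ ⟨z, rfl⟩
    by_cases hz : ‖z - c‖ ≤ 1
    · exact (hM _ ⟨z, by simpa [dist_eq_norm] using hz, rfl⟩).trans (le_max_left _ _)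
    · push Not at hz
      refine le_trans ?_ (le_max_right _ _)
      have h1 : (z - c) ^ 2 * d z = g z - g c - (z - c) * a := by
        rw [hexp z]; ring
      have h2 : ‖z - c‖ ^ 2 * ‖d z‖ ≤ ‖g z‖ + ‖g c‖ + ‖z - c‖ * ‖a‖ := by
        rw [← norm_pow, ← norm_mul, h1, ← norm_mul]
        exact (norm_sub_le _ _).trans (by gcongr; exact norm_sub_le _ _)
      have h3 : 1 ≤ ‖z - c‖ ^ 2 := by nlinarith
      have h4 : ‖z - c‖ ≤ ‖z - c‖ ^ 2 := by nlinarith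
      have h5 : ‖z - c‖ ^ 2 * ‖d z‖ ≤ ‖z - c‖ ^ 2 * (C + ‖g c‖ + ‖a‖) := by
        nlinarith [hC z hz, mul_le_mul_of_nonneg_right h3 (norm_nonneg (g c)),
          mul_le_mul_of_nonneg_right h4 (norm_nonneg a)]
      exact le_of_mul_le_mul_left h5 (by linarith)
  have hconst : ∀ z, d z = d c := fun z => hdd.apply_eq_apply_of_bounded hbdd z c
  let p : Polynomial ℂ := Polynomial.C (g c) + Polynomial.X *
    (Polynomial.C a + Polynomial.X * Polynomial.C (d c))
  have hp : ∀ z, g z = p.eval (z - c) := fun z => by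
    rw [hexp z, hconst z]
    simp only [p, Polynomial.eval_add, Polynomial.eval_mul, Polynomial.eval_C, Polynomial.eval_X]
  have hdeg : p.degree = 0 := by
    by_contra h
    obtain ⟨x, hx⟩ := IsAlgClosed.exists_root p h
    refine h0 (x + c) ?_
    rw [hp, add_sub_cancel_right]
    exact hx
  rw [hp, hp c, Polynomial.eq_C_of_degree_eq_zero hdeg, Polynomial.eval_C, Polynomial.eval_C]

/-- Comparing the hypotheses at `t` and `u` gives `A = B`; polarization then yields the inner
product that makes the squared norm of the defect vanish. -/
theorem eq_lineMap_of_norm_sub_sq {E : Type*} [NormedAddCommGroup E] [InnerProductSpace ℝ E]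
    {g : ℝ → E} {t u A B : ℝ} (htu : t ≠ u) (hA : ∀ s, ‖g s - g t‖ ^ 2 = A * (s - t) ^ 2)
    (hB : ∀ s, ‖g s - g u‖ ^ 2 = B * (s - u) ^ 2) (s : ℝ) :
    g s = g t + ((s - t) / (u - t)) • (g u - g t) := by
  have hne : u - t ≠ 0 := sub_ne_zero.2 htu.symm
  have hAB : A = B := by
    have h1 := hA u
    rw [norm_sub_rev, hB t] at h1
    have : (A - B) * (u - t) ^ 2 = 0 := by linear_combination -h1
    simpa [hne, sub_eq_zero] using this
  subst hAB
  have h := hB s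
  rw [← sub_sub_sub_cancel_right _ _ (g t), norm_sub_sq_real, hA s, hA u] at h
  have h2 : ⟪g s - g t, g u - g t⟫_ℝ = A * (s - t) * (u - t) := by linear_combination -h / 2
  rw [← sub_eq_iff_eq_add', ← sub_eq_zero, ← norm_eq_zero, ← sq_eq_zero_iff, norm_sub_sq_real,
    norm_smul, mul_pow, inner_smul_right, hA s, hA u, h2, Real.norm_eq_abs, sq_abs]
  field_simp
  ring

theorem isSliceRegular_affine (a b : ℍ[ℝ]) : IsSliceRegular fun q => q * a + b := by
  refine ⟨by fun_prop, fun I hI x y => ?_⟩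
  have hx : HasDerivAt (fun t : ℝ => ((t : ℍ[ℝ]) + I * (y : ℍ[ℝ])) * a + b) a x := by
    have := (((hasDerivAt_id x).smul_const a).add_const (I * (y : ℍ[ℝ]) * a)).add_const b
    simpa [add_mul, Quaternion.coe_mul_eq_smul] using this
  have hy : HasDerivAt (fun t : ℝ => ((x : ℍ[ℝ]) + I * (t : ℍ[ℝ])) * a + b) (I * a) y := by
    have := (((hasDerivAt_id y).smul_const (I * a)).const_add ((x : ℍ[ℝ]) * a)).add_const b
    simpa [add_mul, Quaternion.mul_coe_eq_smul] using this
  rw [dbar, hx.deriv, hy.deriv, ← mul_assoc, ← pow_two, show I ^ 2 = -1 from hI, neg_one_mul,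
    add_neg_cancel, smul_zero]

/-- Zeros of a jointly continuous family of entire functions persist: if one member vanishes at
`z₀` but not on a circle around `z₀`, then nearby members have zeros in the closed disc. -/
theorem eventually_exists_zero {X : Type*} [TopologicalSpace X] {N : X → ℂ → ℂ}
    (hN : Continuous fun p : X × ℂ => N p.1 p.2) (hd : ∀ c, Differentiable ℂ (N c))
    {c₀ : X} {z₀ : ℂ} {r : ℝ} (hr : 0 < r) (h0 : N c₀ z₀ = 0)
    (hne : ∀ z ∈ Metric.sphere z₀ r, N c₀ z ≠ 0) :
    ∀ᶠ c in nhds c₀, ∃ z ∈ Metric.closedBall z₀ r, N c z = 0 := by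
  obtain ⟨w, hw, hmin⟩ := (isCompact_sphere z₀ r).exists_isMinOn
    (NormedSpace.sphere_nonempty.2 hr.le) (hd c₀).continuous.norm.continuousOn
  have hm : 0 < ‖N c₀ w‖ := norm_pos_iff.2 (hne w hw)
  have h1 : ∀ᶠ c in nhds c₀, ∀ z ∈ Metric.sphere z₀ r, ‖N c₀ w‖ / 2 < ‖N c z‖ := by
    refine (isCompact_sphere z₀ r).eventually_forall_of_forall_eventually fun z hz => ?_
    refine hN.norm.continuousAt.eventually_const_lt ?_
    have := isMinOn_iff.1 hmin z hz
    simp only at this ⊢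
    linarith
  have h2 : ∀ᶠ c in nhds c₀, ‖N c z₀‖ < ‖N c₀ w‖ / 2 := by
    have : Continuous fun c => ‖N c z₀‖ := (hN.comp (Continuous.prodMk_left z₀)).norm
    exact this.continuousAt.eventually_lt_const (by simp [h0, hm])
  filter_upwards [h1, h2] with c hc1 hc2
  by_contra! hcon
  -- Without zeros, the maximum principle for `1 / N c` would contradict `N c` being smaller at the
  -- centre than on the circle.
  have hinv : DiffContOnCl ℂ (fun z => (N c z)⁻¹) (Metric.ball z₀ r) := by
    refine (hd c).diffContOnCl.inv fun z hz => hcon z ?_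
    rwa [closure_ball _ hr.ne'] at hz
  have := Complex.norm_le_of_forall_mem_frontier_norm_le Metric.isBounded_ball hinv
    (C := (‖N c₀ w‖ / 2)⁻¹) (fun z hz => ?_) (subset_closure (Metric.mem_ball_self hr))
  · rw [norm_inv] at this
    have hpos : 0 < ‖N c z₀‖ := norm_pos_iff.2 (hcon z₀ (Metric.mem_closedBall_self hr.le))
    exact absurd ((inv_le_inv₀ hpos (by positivity)).1 this) (not_le.2 hc2)
  · rw [frontier_ball _ hr.ne'] at hz
    rw [norm_inv]
    exact inv_anti₀ (by positivity) (hc1 z hz).le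

/-! ### Injective regular functions -/

section Stem

variable {ι : Type*} [Fintype ι] {b : OrthonormalBasis ι ℝ ℍ[ℝ]} {f : ℍ[ℝ] → ℍ[ℝ]}
  {F : ι → ℂ → ℂ}

theorem deriv_stem_im (hd : ∀ k, Differentiable ℂ (F k))
    (hr : ∀ k, ∀ t : ℝ, F k t = (⟪b k, f t⟫_ℝ : ℂ)) (k : ι) (t : ℝ) :
    (deriv (F k) t).im = 0 := by
  have h1 := Complex.imCLM.hasFDerivAt.comp_hasDerivAt t ((hd k t).hasDerivAt.comp_ofReal)
  have h2 : (Complex.imCLM ∘ fun s : ℝ => F k s) = fun _ => 0 := by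
    funext s
    simp [hr]
  rw [h2] at h1
  exact h1.unique (hasDerivAt_const t 0)

theorem exists_norm_sub_sq_eq (hinj : Function.Injective f) (hd : ∀ k, Differentiable ℂ (F k))
    (hr : ∀ k, ∀ t : ℝ, F k t = (⟪b k, f t⟫_ℝ : ℂ))
    (hF : ∀ I ∈ imaginaryUnits, ∀ z, f (sliceMap I z) =
      ∑ k, (F k z).re • b k + I * ∑ k, (F k z).im • b k)
    {t : ℝ} (ht : ∃ k, deriv (F k) t ≠ 0) :
    ∃ A : ℝ, ∀ s : ℝ, ‖f s - f t‖ ^ 2 = A * (s - t) ^ 2 := by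
  let N : ℍ[ℝ] → ℂ → ℂ := fun c z => ∑ k, (F k z - (⟪b k, c⟫_ℝ : ℂ)) ^ 2
  have hNd : ∀ c, Differentiable ℂ (N c) := fun c =>
    Differentiable.fun_sum fun k _ => ((hd k).sub_const _).pow 2
  have hNc : Continuous fun p : ℍ[ℝ] × ℂ => N p.1 p.2 := by
    refine continuous_finsetSum _ fun k _ => ?_
    have := (hd k).continuous
    fun_prop
  have hbound := exists_norm_sub_sq_le b hF
  have hzero : ∀ c z, N c z = 0 → ∃ I ∈ imaginaryUnits, f (sliceMap I z) = c := by
    intro c z h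
    obtain ⟨I, hI, hle⟩ := hbound c z
    refine ⟨I, hI, ?_⟩
    change _ ≤ ‖N c z‖ at hle
    rw [h, norm_zero] at hle
    exact sub_eq_zero.1 (norm_eq_zero.1 (pow_eq_zero_iff two_ne_zero |>.1
      (le_antisymm hle (sq_nonneg _))))
  have hdist : ∀ I ∈ imaginaryUnits, ∀ z, ‖sliceMap I z - t‖ = ‖z - t‖ := fun I hI z => by
    rw [← sliceMap_ofReal I, ← map_sub, norm_sliceMap hI]
  have hNt : ∀ z, N (f t) z = 0 → z = t := by
    intro z h
    obtain ⟨I, hI, hz⟩ := hzero _ _ h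
    have := hdist I hI z
    rw [hinj hz, sub_self, norm_zero] at this
    exact sub_eq_zero.1 (norm_eq_zero.1 this.symm)
  -- Values near `f t` are taken in the closed unit ball around `t`, hence not outside it.
  obtain ⟨δ, hδ, hfar⟩ : ∃ δ > 0, ∀ z : ℂ, 1 < ‖z - t‖ → δ ^ 2 ≤ ‖N (f t) z‖ := by
    have hev := eventually_exists_zero hNc hNd (c₀ := f t) (z₀ := t) one_pos (by simp [N, hr])
      fun z hz h => by simp [hNt z h] at hz
    obtain ⟨δ, hδ, hball⟩ := Metric.eventually_nhds_iff.1 hev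
    refine ⟨δ, hδ, fun z hz => ?_⟩
    obtain ⟨I, hI, hle⟩ := hbound (f t) z
    refine le_trans ?_ hle
    refine pow_le_pow_left₀ hδ.le ?_ 2
    by_contra! hlt
    obtain ⟨w, hw, hNw⟩ := hball (y := f (sliceMap I z)) (by rwa [dist_eq_norm])
    obtain ⟨J, hJ, hJw⟩ := hzero _ _ hNw
    have h1 := hdist I hI z
    rw [← hinj hJw, hdist J hJ w] at h1
    rw [Metric.mem_closedBall, dist_eq_norm, h1] at hw
    linarith
  let h : ℂ → ℂ := fun z => ∑ k, dslope (F k) t z ^ 2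
  have hh : Differentiable ℂ h :=
    Differentiable.fun_sum fun k _ => (differentiable_dslope (hd k) t).pow 2
  have hNh : ∀ z, N (f t) z = (z - t) ^ 2 * h z := by
    intro z
    simp only [N, h, Finset.mul_sum]
    refine Finset.sum_congr rfl fun k _ => ?_
    rw [← hr, sub_mul_dslope_add (F k) t z]
    ring
  have hh0 : ∀ z, h z ≠ 0 := by
    intro z hz
    obtain rfl : z = t := hNt z (by rw [hNh, hz, mul_zero])
    obtain ⟨k, hk⟩ := ht
    -- The derivatives are real at `t`, so their squares cannot cancel.
    have hre : h t = ((∑ k, (deriv (F k) t).re ^ 2 : ℝ) : ℂ) := by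
      simp only [h, dslope_same]
      push_cast
      refine Finset.sum_congr rfl fun k _ => ?_
      congr 1
      exact Complex.ext (by simp) (by simp [deriv_stem_im hd hr])
    rw [hre, Complex.ofReal_eq_zero, Finset.sum_eq_zero_iff_of_nonneg fun _ _ => sq_nonneg _] at hz
    refine hk (Complex.ext ?_ (deriv_stem_im hd hr k t))
    simpa using hz k (Finset.mem_univ k)
  have hconst : ∀ z, h z = h t := by
    intro z
    refine inv_injective (eq_const_of_ne_zero_of_norm_le_sq (g := fun z => (h z)⁻¹) (c := t)
      (C := (δ ^ 2)⁻¹) (hh.inv hh0) (fun z => inv_ne_zero (hh0 z)) (fun z hz => ?_) z)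
    have h1 := hfar z hz
    rw [hNh, norm_mul, norm_pow] at h1
    have h2 : 0 < ‖h z‖ := norm_pos_iff.2 (hh0 z)
    rw [norm_inv, inv_mul_eq_div, le_div_iff₀ (by positivity), inv_mul_le_iff₀ h2, mul_comm]
    exact h1
  refine ⟨(h t).re, fun s => ?_⟩
  have hs : ((‖f s - f t‖ ^ 2 : ℝ) : ℂ) = ((s - t) ^ 2 : ℝ) * h t := by
    rw [← hconst s, Complex.ofReal_pow (s - t), Complex.ofReal_sub, ← hNh, ← b.sum_sq_inner_right]
    push_cast [N]
    refine Finset.sum_congr rfl fun k _ => ?_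
    rw [hr, inner_sub_right, Complex.ofReal_sub]
  have := congrArg Complex.re hs
  rw [Complex.re_ofReal_mul, Complex.ofReal_re] at this
  rw [this, mul_comm]

end Stem

/-! ### Classification -/

theorem IsSliceRegular.isRegularAffine_of_injective {f : ℍ[ℝ] → ℍ[ℝ]} (hf : IsSliceRegular f)
    (hinj : Function.Injective f) : IsRegularAffine f := by
  obtain ⟨F, hd, hr, hF⟩ := exists_stem (stdOrthonormalBasis ℝ ℍ[ℝ]) hf
  obtain ⟨t, k, hk⟩ : ∃ t : ℝ, ∃ k, deriv (F k) t ≠ 0 := by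
    by_contra! hcon
    have h01 : f (0 : ℝ) = f (1 : ℝ) := by
      rw [← (stdOrthonormalBasis ℝ ℍ[ℝ]).sum_repr' (f (0 : ℝ)),
        ← (stdOrthonormalBasis ℝ ℍ[ℝ]).sum_repr' (f (1 : ℝ))]
      refine Finset.sum_congr rfl fun k _ => ?_
      congr 1
      have h0 : deriv (F k) = fun _ => 0 :=
        eq_of_forall_ofReal_eq (hd k).deriv (differentiable_const 0) fun t => hcon t k
      have := is_const_of_deriv_eq_zero (hd k) (congrFun h0) (0 : ℝ) (1 : ℝ)
      rwa [hr, hr, Complex.ofReal_inj] at this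
    have := hinj h01
    norm_num at this
  -- Continuity of the derivative supplies the second base point.
  obtain ⟨u, hu, hut⟩ : ∃ u : ℝ, deriv (F k) u ≠ 0 ∧ u ≠ t := by
    have hc : Continuous fun s : ℝ => deriv (F k) s :=
      (hd k).deriv.continuous.comp Complex.continuous_ofReal
    have h1 : ∀ᶠ s : ℝ in nhdsWithin t {t}ᶜ, deriv (F k) s ≠ 0 :=
      (hc.continuousAt.eventually_ne hk).filter_mono nhdsWithin_le_nhds
    exact (h1.and self_mem_nhdsWithin).exists
  obtain ⟨A, hA⟩ := exists_norm_sub_sq_eq hinj hd hr hF ⟨k, hk⟩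
  obtain ⟨B, hB⟩ := exists_norm_sub_sq_eq hinj hd hr hF ⟨k, hu⟩
  have hline := eq_lineMap_of_norm_sub_sq (g := fun s : ℝ => f s) hut.symm hA hB
  set a : ℍ[ℝ] := (u - t)⁻¹ • (f u - f t) with ha
  have hfa : f = fun q => q * a + (f t - t * a) := by
    refine hf.eq_of_forall_coe_eq (isSliceRegular_affine _ _) fun s => ?_
    rw [hline s, div_eq_mul_inv, mul_smul, ← ha, Quaternion.coe_mul_eq_smul,
      Quaternion.coe_mul_eq_smul, sub_smul]
    abel
  refine ⟨a, f t - t * a, ?_, congrFun hfa⟩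
  refine smul_ne_zero (inv_ne_zero (sub_ne_zero.2 hut)) (sub_ne_zero.2 fun h => hut ?_)
  exact Quaternion.coe_injective (hinj h)

theorem IsRegularAffine.isSliceRegular {f : ℍ[ℝ] → ℍ[ℝ]} (hf : IsRegularAffine f) :
    IsSliceRegular f := by
  obtain ⟨a, b, -, h⟩ := hf
  rw [funext h]
  exact isSliceRegular_affine a b

theorem IsRegularAffine.isBiregular {f : ℍ[ℝ] → ℍ[ℝ]} (hf : IsRegularAffine f) :
    IsBiregular f := by
  refine ⟨hf.isSliceRegular, ?_⟩
  obtain ⟨a, b, ha, h⟩ := hf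
  refine ⟨fun q => q * a⁻¹ + -(b * a⁻¹), isSliceRegular_affine _ _, fun q => ?_, fun q => ?_⟩
  · simp only [h]
    rw [add_mul, mul_inv_cancel_right₀ ha, add_neg_cancel_right]
  · rw [h, add_mul, neg_mul, inv_mul_cancel_right₀ ha, inv_mul_cancel_right₀ ha,
      neg_add_cancel_right]

theorem isBiregular_iff_isRegularAffine (f : ℍ[ℝ] → ℍ[ℝ]) :
    IsBiregular f ↔ IsRegularAffine f :=
  ⟨fun ⟨hf, _, _, hg, _⟩ => hf.isRegularAffine_of_injective hg.injective, fun h => h.isBiregular⟩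

theorem IsRegularAffine.injective {f : ℍ[ℝ] → ℍ[ℝ]} (hf : IsRegularAffine f) :
    Function.Injective f := by
  obtain ⟨-, g, -, hg, -⟩ := hf.isBiregular
  exact hg.injective

end SliceRegular
end

theorem theorem3p4 :
    (∀ f : ℍ[ℝ] → ℍ[ℝ],
      (SliceRegular.IsSliceRegular f ∧ Function.Injective f) ↔
        ∃ a b : ℍ[ℝ], a ≠ 0 ∧ ∀ q : ℍ[ℝ], f q = q * a + b) ∧
    (∀ f : ℍ[ℝ] → ℍ[ℝ], SliceRegular.IsBiregular f ↔ SliceRegular.IsRegularAffine f) ∧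
    SliceRegular.aut = (SliceRegular.affineGroup : Set (Equiv.Perm ℍ[ℝ])) := by
  refine ⟨fun f => ⟨fun h => h.1.isRegularAffine_of_injective h.2, fun h => ?_⟩,
    SliceRegular.isBiregular_iff_isRegularAffine, ?_⟩
  · have h' : SliceRegular.IsRegularAffine f := h
    exact ⟨h'.isSliceRegular, h'.injective⟩
  · ext e
    exact SliceRegular.isBiregular_iff_isRegularAffine e
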